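/- **Theorem 1.3.** Let $(K,\nu_0)$ be a valued field and let $\Gamma$ be a divisible totally ordered abelian group containing the value group of $\nu_0$; put $\Gamma_\infty=\Gamma\cup\{\infty\}$. Let $\mathcal V$ be the set consisting of $\nu_0$ and of all valuations $\nu:K[x]\to\Gamma_\infty$ extending $\nu_0$ (the support $\operatorname{supp}(\nu)=\{f\mid \nu(f)=\infty\}$ may be nonzero), partially ordered by letting $\nu_0$ be the least element and, for $\nu,\mu\neq\nu_0$, $\nu\le\mu$ if and only if $\nu(f)\le\mu(f)$ for all $f\in K[x]$. Fix a monic irreducible polynomial $F\in K[x]$, and set $$\mathcal V_{F_\infty}=\{\mu\in\mathcal V\mid \operatorname{supp}(\mu)=(F)\},\qquad \mathcal V_F=\{\nu\in\mathcal V\mid \nu\le\mu\text{ for some }\mu\in\mathcal V_{F_\infty}\}.$$ For $\nu\in\mathcal V\setminus\{\nu_0\}$ let $\mathcal G_\nu=\bigoplus_{\gamma}\{f\mid\nu(f)\ge\gamma\}/\{f\mid\nu(f)>\gamma\}$, where $\gamma$ runs over the finite values of $\nu$, be the graded ring of $\nu$ on $K[x]$, and let $\mathrm{in}_\nu(f)\in\mathcal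 G_\nu$ be the class of $f$ in degree $\nu(f)$ if $\nu(f)\neq\infty$, and $\mathrm{in}_\nu(f)=0$ otherwise. Let $\nu\in\mathcal V_F\setminus\{\nu_0\}$ be non-maximal in $\mathcal V$. Then $\mathrm{in}_\nu(F)$ can be written as $$\mathrm{in}_\nu(F)=u\cdot\prod_{i=1}^n\phi_i^{r_i},\qquad r_i\ge 1,$$ where $u$ is a unit of $\mathcal G_\nu$, each $\phi_i\in\mathcal G_\nu$ is homogeneous and irreducible, and $\phi_i\nmid\phi_j$ for $i\neq j$. Moreover, for every such expression there are $n$ distinct valuations $\mu_1,\dots,\mu_n\in\mathcal V_{F_\infty}$ with $\nu<\mu_i$ for every $i$, $1\le i\le n$. -/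

import Mathlib

open Polynomial
open scoped DirectSum

noncomputable section

namespace ApproachF

/-! ### The graded ring of a valuation

Valuations are written additively, with values in `Γ_∞ = WithTop Γ`; they are Mathlib's
`AddValuation`s (the support may be a nonzero prime ideal). -/

section GradedRing

variable {R : Type*} [CommRing R]
variable {Γ : Type*} [AddCommGroup Γ] [LinearOrder Γ] [IsOrderedAddMonoid Γ]

/-- `P_γ = {a ∈ R | ν(a) ≥ γ}`. -/
def levelGe (ν : AddValuation R (WithTop Γ)) (γ : Γ) : AddSubgroup R where
  carrier := {a | (γ : WithTop Γ) ≤ ν a}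
  zero_mem' := by simp
  add_mem' ha hb := ν.map_le_add ha hb
  neg_mem' ha := by simpa [ν.map_neg] using ha

/-- `P_γ⁺ = {a ∈ R | ν(a) > γ}`. -/
def levelGt (ν : AddValuation R (WithTop Γ)) (γ : Γ) : AddSubgroup R where
  carrier := {a | (γ : WithTop Γ) < ν a}
  zero_mem' := by simp
  add_mem' ha hb := ν.map_lt_add ha hb
  neg_mem' ha := by simpa [ν.map_neg] using ha

/-- The homogeneous component `P_γ / P_γ⁺` of degree `γ`. -/
abbrev GrComp (ν : AddValuation R (WithTop Γ)) (γ : Γ) : Type _ :=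
  levelGe ν γ ⧸ (levelGt ν γ).addSubgroupOf (levelGe ν γ)

/-- The class in `P_γ / P_γ⁺` of an element `a` with `ν(a) ≥ γ`. -/
def GrComp.mk (ν : AddValuation R (WithTop Γ)) (γ : Γ) (a : R) (ha : (γ : WithTop Γ) ≤ ν a) :
    GrComp ν γ :=
  QuotientAddGroup.mk (s := (levelGt ν γ).addSubgroupOf (levelGe ν γ)) ⟨a, ha⟩

theorem GrComp.mk_eq_zero_iff {ν : AddValuation R (WithTop Γ)} {γ : Γ} {a : R}
    {ha : (γ : WithTop Γ) ≤ ν a} : GrComp.mk ν γ a ha = 0 ↔ (γ : WithTop Γ) < ν a := by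
  unfold GrComp.mk
  rw [QuotientAddGroup.eq_zero_iff]
  rfl

theorem GrComp.mk_surj {ν : AddValuation R (WithTop Γ)} {γ : Γ} (x : GrComp ν γ) :
    ∃ a, ∃ ha : (γ : WithTop Γ) ≤ ν a, x = GrComp.mk ν γ a ha := by
  obtain ⟨⟨a, ha⟩, rfl⟩ := QuotientAddGroup.mk_surjective x
  exact ⟨a, ha, rfl⟩

/-- The component of degree `γ` vanishes when `γ` is not a value of `ν`: the direct sum over all
`γ ∈ Γ` is the direct sum over the finite values of `ν`. -/
theorem GrComp.subsingleton_of_not_value (ν : AddValuation R (WithTop Γ)) (γ : Γ)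
    (h : ∀ a, ν a ≠ (γ : WithTop Γ)) : Subsingleton (GrComp ν γ) := by
  refine subsingleton_of_forall_eq 0 fun x => ?_
  obtain ⟨a, ha, rfl⟩ := GrComp.mk_surj x
  exact GrComp.mk_eq_zero_iff.2 (lt_of_le_of_ne ha (h a).symm)

theorem mul_mem_levelGe {ν : AddValuation R (WithTop Γ)} {γ δ : Γ} {a b : R}
    (ha : (γ : WithTop Γ) ≤ ν a) (hb : (δ : WithTop Γ) ≤ ν b) :
    ((γ + δ : Γ) : WithTop Γ) ≤ ν (a * b) := by
  rw [ν.map_mul, WithTop.coe_add]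
  exact add_le_add ha hb

theorem mul_lt_of_lt {ν : AddValuation R (WithTop Γ)} {γ δ : Γ} {a b : R}
    (ha : (γ : WithTop Γ) < ν a) (hb : (δ : WithTop Γ) ≤ ν b) :
    ((γ + δ : Γ) : WithTop Γ) < ν (a * b) := by
  rw [ν.map_mul, WithTop.coe_add]
  exact WithTop.add_lt_add_of_lt_of_le WithTop.coe_ne_top ha hb

/-- Multiplication `P_γ / P_γ⁺ × P_δ / P_δ⁺ → P_{γ+δ} / P_{γ+δ}⁺`, induced by that of `R`. -/
def GrComp.mul (ν : AddValuation R (WithTop Γ)) {γ δ : Γ} :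
    GrComp ν γ →+ GrComp ν δ →+ GrComp ν (γ + δ) :=
  QuotientAddGroup.lift _
    (AddMonoidHom.mk'
      (fun a : levelGe ν γ => QuotientAddGroup.lift ((levelGt ν δ).addSubgroupOf (levelGe ν δ))
        (AddMonoidHom.mk' (fun b : levelGe ν δ =>
            GrComp.mk ν (γ + δ) (a.1 * b.1) (mul_mem_levelGe a.2 b.2))
          (fun b c => by
            unfold GrComp.mk
            rw [← QuotientAddGroup.mk_add]
            congr 1
            exact Subtype.ext (mul_add _ _ _)))
        (fun b hb => by
          refine GrComp.mk_eq_zero_iff (ν := ν).2 ?_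
          rw [mul_comm a.1 b.1, add_comm γ δ]
          exact mul_lt_of_lt (ν := ν) hb a.2))
      (fun a a' => by
        refine AddMonoidHom.ext fun y => ?_
        obtain ⟨b, rfl⟩ := QuotientAddGroup.mk_surjective y
        change GrComp.mk ν (γ + δ) ((a.1 + a'.1) * b.1) (mul_mem_levelGe (a + a').2 b.2) =
          GrComp.mk ν (γ + δ) (a.1 * b.1) (mul_mem_levelGe a.2 b.2) +
          GrComp.mk ν (γ + δ) (a'.1 * b.1) (mul_mem_levelGe a'.2 b.2)
        unfold GrComp.mk
        rw [← QuotientAddGroup.mk_add]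
        congr 1
        exact Subtype.ext (add_mul _ _ _)))
    (fun a ha => by
      refine AddMonoidHom.ext fun y => ?_
      obtain ⟨b, rfl⟩ := QuotientAddGroup.mk_surjective y
      exact GrComp.mk_eq_zero_iff.2 (mul_lt_of_lt (ν := ν) ha b.2))

theorem GrComp.mul_mk_mk (ν : AddValuation R (WithTop Γ)) {γ δ : Γ} {a b : R}
    (ha : (γ : WithTop Γ) ≤ ν a) (hb : (δ : WithTop Γ) ≤ ν b) :
    GrComp.mul ν (GrComp.mk ν γ a ha) (GrComp.mk ν δ b hb) =
      GrComp.mk ν (γ + δ) (a * b) (mul_mem_levelGe ha hb) := rfl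

theorem GrComp.sigma_ext (ν : AddValuation R (WithTop Γ)) {γ δ : Γ} (h : γ = δ) {a b : R}
    (hab : a = b) (ha : (γ : WithTop Γ) ≤ ν a) (hb : (δ : WithTop Γ) ≤ ν b) :
    GradedMonoid.mk (A := GrComp ν) γ (GrComp.mk ν γ a ha) =
      GradedMonoid.mk δ (GrComp.mk ν δ b hb) := by
  subst h hab
  rfl

instance GrComp.gMul (ν : AddValuation R (WithTop Γ)) : GradedMonoid.GMul (GrComp ν) where
  mul x y := GrComp.mul ν x y

instance GrComp.gOne (ν : AddValuation R (WithTop Γ)) : GradedMonoid.GOne (GrComp ν) where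
  one := GrComp.mk ν 0 1 (by simp)

instance GrComp.gCommRing (ν : AddValuation R (WithTop Γ)) :
    DirectSum.GCommRing (GrComp ν) where
  mul_zero x := map_zero _
  zero_mul y := by change GrComp.mul ν 0 y = 0; simp
  mul_add x y z := map_add _ _ _
  add_mul x y z := by
    change GrComp.mul ν (x + y) z = GrComp.mul ν x z + GrComp.mul ν y z
    simp
  one_mul := by
    rintro ⟨γ, x⟩
    obtain ⟨a, ha, rfl⟩ := GrComp.mk_surj x
    exact GrComp.sigma_ext ν (zero_add γ) (one_mul a) _ _
  mul_one := by
    rintro ⟨γ, x⟩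
    obtain ⟨a, ha, rfl⟩ := GrComp.mk_surj x
    exact GrComp.sigma_ext ν (add_zero γ) (mul_one a) _ _
  mul_assoc := by
    rintro ⟨γ, x⟩ ⟨δ, y⟩ ⟨ε, z⟩
    obtain ⟨a, ha, rfl⟩ := GrComp.mk_surj x
    obtain ⟨b, hb, rfl⟩ := GrComp.mk_surj y
    obtain ⟨c, hc, rfl⟩ := GrComp.mk_surj z
    exact GrComp.sigma_ext ν (add_assoc γ δ ε) (mul_assoc a b c) _ _
  mul_comm := by
    rintro ⟨γ, x⟩ ⟨δ, y⟩
    obtain ⟨a, ha, rfl⟩ := GrComp.mk_surj x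
    obtain ⟨b, hb, rfl⟩ := GrComp.mk_surj y
    exact GrComp.sigma_ext ν (add_comm γ δ) (mul_comm a b) _ _
  natCast n := n • GrComp.mk ν 0 1 (by simp)
  natCast_zero := zero_nsmul _
  natCast_succ n := succ_nsmul _ n
  intCast z := z • GrComp.mk ν 0 1 (by simp)
  intCast_ofNat n := natCast_zsmul _ n
  intCast_negSucc_ofNat n := negSucc_zsmul _ n

/-- The graded ring `gr_ν(R) = ⨁_γ P_γ / P_γ⁺`. -/
abbrev Gr (ν : AddValuation R (WithTop Γ)) : Type _ := ⨁ γ, GrComp ν γ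

/-- The initial form `in_ν(a) ∈ gr_ν(R)`: the class of `a` in `P_{ν(a)} / P_{ν(a)}⁺` if
`ν(a) ≠ ∞`, and `0` if `a` lies in the support of `ν`. -/
def initialForm (ν : AddValuation R (WithTop Γ)) (a : R) : Gr ν :=
  open Classical in
  if h : ν a = ⊤ then 0
  else DirectSum.of (GrComp ν) ((ν a).untop h) (GrComp.mk ν _ a (WithTop.coe_untop _ h).le)

/-- Homogeneous elements of `gr_ν(R)`: those lying in one summand `P_γ / P_γ⁺`. -/
def IsHomogeneous (ν : AddValuation R (WithTop Γ)) (φ : Gr ν) : Prop :=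
  ∃ (γ : Γ) (x : GrComp ν γ), φ = DirectSum.of (GrComp ν) γ x

end GradedRing

/-! ### The poset of valuations on `K[x]` extending a valuation of `K` -/

section Poset

variable {K : Type*} [Field K]
variable {Γ : Type*} [AddCommGroup Γ] [LinearOrder Γ] [IsOrderedAddMonoid Γ]

/-- The valuations `ν : K[x] → Γ_∞` that extend `ν₀`. -/
def Ext (ν₀ : AddValuation K (WithTop Γ)) : Type _ :=
  {ν : AddValuation K[X] (WithTop Γ) // ∀ a : K, ν (C a) = ν₀ a}

/-- `ν ≤ μ` if and only if `ν(f) ≤ μ(f)` for all `f ∈ K[x]`. -/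
instance Ext.partialOrder (ν₀ : AddValuation K (WithTop Γ)) : PartialOrder (Ext ν₀) where
  le ν μ := ∀ f : K[X], ν.1 f ≤ μ.1 f
  le_refl ν f := le_rfl
  le_trans ν μ ρ h₁ h₂ f := (h₁ f).trans (h₂ f)
  le_antisymm ν μ h₁ h₂ :=
    Subtype.ext (AddValuation.ext fun f => le_antisymm (h₁ f) (h₂ f))

/-- The poset `𝒱 = {ν₀} ∪ {ν : K[x] → Γ_∞ | ν a valuation extending ν₀}`, whose least element
`ν₀` is the bottom element added to `Ext ν₀`. -/
abbrev 𝒱 (ν₀ : AddValuation K (WithTop Γ)) : Type _ := WithBot (Ext ν₀)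

/-- `𝒱_{F_∞}`: the valuations in `𝒱` with support the ideal `(F)` of `K[x]`. -/
def VSupp (ν₀ : AddValuation K (WithTop Γ)) (F : K[X]) : Set (𝒱 ν₀) :=
  {μ | ∃ m : Ext ν₀, μ = (m : 𝒱 ν₀) ∧ m.1.supp = Ideal.span {F}}

/-- `𝒱_F`: the elements of `𝒱` lying below some valuation with support `(F)`. -/
def VApproach (ν₀ : AddValuation K (WithTop Γ)) (F : K[X]) : Set (𝒱 ν₀) :=
  {ν | ∃ μ ∈ VSupp ν₀ F, ν ≤ μ}

/-- `in_ν(F) = u · ∏_{i=1}^n φ_i^{r_i}` with `u` a unit of `𝒢_ν = gr_ν(K[x])`, `r_i ≥ 1`, and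
homogeneous irreducible elements `φ_i` such that `φ_i ∤ φ_j` for `i ≠ j`. -/
structure IsInitialFactorization (ν : AddValuation K[X] (WithTop Γ)) (F : K[X]) (n : ℕ)
    (u : Gr ν) (φ : Fin n → Gr ν) (r : Fin n → ℕ) : Prop where
  isUnit : IsUnit u
  homogeneous : ∀ i, IsHomogeneous ν (φ i)
  irreducible : ∀ i, Irreducible (φ i)
  not_dvd : ∀ i j, i ≠ j → ¬ φ i ∣ φ j
  pos : ∀ i, 1 ≤ r i
  eq : initialForm ν F = u * ∏ i, φ i ^ r i

end Poset

end ApproachF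

end

/-!
# Extending initial-form factorizations to valuations with prescribed support

Write `G = gr_ν(K[x])`. Since `ν` is not maximal, its support is zero: a valuation with nonzero
support `(p)` is a valuation of the field `K[x]/(p)`, where comparable valuations coincide
(`eq_zero_of_not_isMax`). Two facts carry the argument.

*Existence of valuations* (`exists_ext_of_irreducible`). Let `p` be irreducible and let `I` be a
proper ideal of `G` containing `in_ν(p)`. The Rees ring `⨁_γ P_γ` maps onto `G`, and it maps to the
group algebra `L[T^Γ]` over `L = K[x]/(p)` by `f ↦ f̄ T^γ`. The kernel of the second map is sent into
`I` by the first, so `I` induces a proper ideal of a subring of `L[T^Γ]`, which Chevalley's theorem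
dominates by a valuation of the fraction field. The values of `L` are in the divisible hull of those
of `K`, because `L` is algebraic over `K`; hence they are values of elements `T^{-γ}`, `Γ` being
divisible. This gives a valuation `μ ≥ ν` with support `(p)` and values in `Γ_∞`, such that
`gr_ν → gr_μ` kills the homogeneous elements of `I`.

*Kernels are principal* (`exists_prime_initialForm`). Let `ν < μ` be valuations of `K[x]`, and let `g`
have minimal degree with `ν(g) < μ(g)`. If `ν(f) < μ(f)`, then the remainder `f % g` has
`ν(f % g) > ν(f)`, so that `in_ν(f) = in_ν(f / g) in_ν(g)`. Hence the kernel of `gr_ν → gr_μ` is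
generated by `in_ν(g)`, which is therefore prime, `gr_μ` being a domain.

If `in_ν(f)` is not a unit, then neither is `in_ν(p)` for some irreducible factor `p` of `f`; the
valuation attached to `p` and to `(in_ν(p))` is strictly larger than `ν` at `f`, so a prime `in_ν(g)`
splits off and the factorization follows by induction on the degree. Finally, every irreducible
factor `φ_i` of `in_ν(F)` lies in the kernel of `gr_ν → gr_{μ_i}` for the valuation `μ_i` attached to
`F` and `(φ_i)`. If `μ_i = μ_j`, then `φ_i` and `φ_j` are both associated with the generator of the
same kernel, hence with each other.
-/

open Polynomial
open scoped DirectSum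

noncomputable section

namespace ApproachF

/-! ### Graded rings and the maps between them -/

section GradedRing

variable {R : Type*} [CommRing R]
variable {Γ : Type*} [AddCommGroup Γ] [LinearOrder Γ] [IsOrderedAddMonoid Γ]

theorem of_mk_congr (ν : AddValuation R (WithTop Γ)) {γ δ : Γ} {a b : R} (h : γ = δ)
    (hab : a = b) (ha : (γ : WithTop Γ) ≤ ν a) (hb : (δ : WithTop Γ) ≤ ν b) :
    DirectSum.of (GrComp ν) γ (GrComp.mk ν γ a ha) =
      DirectSum.of (GrComp ν) δ (GrComp.mk ν δ b hb) := by
  subst h hab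
  rfl

theorem initialForm_eq_of (ν : AddValuation R (WithTop Γ)) {γ : Γ} {a : R}
    (h : ν a = (γ : WithTop Γ)) :
    initialForm ν a = DirectSum.of (GrComp ν) γ (GrComp.mk ν γ a h.ge) := by
  have hne : ν a ≠ ⊤ := by simp [h]
  rw [initialForm, dif_neg hne]
  exact of_mk_congr ν (by simp [h]) rfl _ _

theorem initialForm_of_eq_top (ν : AddValuation R (WithTop Γ)) {a : R} (h : ν a = ⊤) :
    initialForm ν a = 0 := by
  rw [initialForm, dif_pos h]

theorem of_mk_of_lt (ν : AddValuation R (WithTop Γ)) {γ : Γ} {a : R}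
    (h : (γ : WithTop Γ) < ν a) : DirectSum.of (GrComp ν) γ (GrComp.mk ν γ a h.le) = 0 := by
  rw [GrComp.mk_eq_zero_iff.2 h, map_zero]

theorem of_mk_mul_of_mk (ν : AddValuation R (WithTop Γ)) {γ δ : Γ} {a b : R}
    (ha : (γ : WithTop Γ) ≤ ν a) (hb : (δ : WithTop Γ) ≤ ν b) :
    DirectSum.of (GrComp ν) γ (GrComp.mk ν γ a ha) *
      DirectSum.of (GrComp ν) δ (GrComp.mk ν δ b hb) =
      DirectSum.of (GrComp ν) (γ + δ) (GrComp.mk ν (γ + δ) (a * b) (mul_mem_levelGe ha hb)) := by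
  rw [DirectSum.of_mul_of]
  rfl

theorem mk_eq_mk_iff (ν : AddValuation R (WithTop Γ)) {γ : Γ} {a b : R}
    (ha : (γ : WithTop Γ) ≤ ν a) (hb : (γ : WithTop Γ) ≤ ν b) :
    GrComp.mk ν γ a ha = GrComp.mk ν γ b hb ↔ (γ : WithTop Γ) < ν (b - a) := by
  unfold GrComp.mk
  rw [QuotientAddGroup.eq]
  change _ < ν (-a + b) ↔ _
  rw [neg_add_eq_sub]

theorem initialForm_ne_zero (ν : AddValuation R (WithTop Γ)) {a : R} (h : ν a ≠ ⊤) :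
    initialForm ν a ≠ 0 := by
  obtain ⟨γ, hγ⟩ := WithTop.ne_top_iff_exists.1 h
  rw [initialForm_eq_of ν hγ.symm]
  intro h0
  have := (DirectSum.of_injective (β := GrComp ν) γ) (h0.trans (map_zero _).symm)
  rw [GrComp.mk_eq_zero_iff] at this
  exact absurd hγ this.ne

theorem initialForm_mul (ν : AddValuation R (WithTop Γ)) (a b : R) :
    initialForm ν (a * b) = initialForm ν a * initialForm ν b := by
  by_cases ha : ν a = ⊤
  · rw [initialForm_of_eq_top ν ha, zero_mul, initialForm_of_eq_top]
    rw [ν.map_mul, ha, top_add]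
  by_cases hb : ν b = ⊤
  · rw [initialForm_of_eq_top ν hb, mul_zero, initialForm_of_eq_top]
    rw [ν.map_mul, hb, add_top]
  obtain ⟨γ, hγ⟩ := WithTop.ne_top_iff_exists.1 ha
  obtain ⟨δ, hδ⟩ := WithTop.ne_top_iff_exists.1 hb
  have hab : ν (a * b) = ((γ + δ : Γ) : WithTop Γ) := by
    rw [ν.map_mul, ← hγ, ← hδ, WithTop.coe_add]
  rw [initialForm_eq_of ν hγ.symm, initialForm_eq_of ν hδ.symm, initialForm_eq_of ν hab,
    of_mk_mul_of_mk]

theorem initialForm_one (ν : AddValuation R (WithTop Γ)) : initialForm ν 1 = 1 :=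
  initialForm_eq_of ν ν.map_one

theorem initialForm_congr (ν : AddValuation R (WithTop Γ)) {a b : R} (h : ν a < ν (b - a)) :
    initialForm ν a = initialForm ν b := by
  obtain ⟨γ, hγ⟩ := WithTop.ne_top_iff_exists.1 h.ne_top
  have hb : ν b = γ := by
    rw [hγ, ← sub_add_cancel b a, add_comm, ν.map_add_eq_of_lt_left h]
  rw [initialForm_eq_of ν hγ.symm, initialForm_eq_of ν hb]
  congr 1
  rw [mk_eq_mk_iff]
  rwa [hγ]

instance (ν : AddValuation R (WithTop Γ)) : Nontrivial (Gr ν) :=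
  ⟨1, 0, by
    rw [← initialForm_one]
    exact initialForm_ne_zero ν (by simp [ν.map_one])⟩

/-- The product of the components of highest degree of two nonzero elements is nonzero, since
`ν` is additive on products. -/
instance (ν : AddValuation R (WithTop Γ)) : NoZeroDivisors (Gr ν) where
  eq_zero_or_eq_zero_of_mul_eq_zero {x y} h := by
    classical
    by_contra! hxy
    obtain ⟨hx, hy⟩ := hxy
    have hsx : (DFinsupp.support x).Nonempty := by
      rw [Finset.nonempty_iff_ne_empty]; exact fun h => hx (DFinsupp.support_eq_empty.1 h)
    have hsy : (DFinsupp.support y).Nonempty := by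
      rw [Finset.nonempty_iff_ne_empty]; exact fun h => hy (DFinsupp.support_eq_empty.1 h)
    set α := (DFinsupp.support x).max' hsx with hα
    set β := (DFinsupp.support y).max' hsy with hβ
    have hxα : x α ≠ 0 := DFinsupp.mem_support_iff.1 (Finset.max'_mem _ hsx)
    have hyβ : y β ≠ 0 := DFinsupp.mem_support_iff.1 (Finset.max'_mem _ hsy)
    have key : (x * y) (α + β) = GrComp.mul ν (x α) (y β) := by
      rw [DirectSum.mul_eq_sum_support_ghas_mul]
      rw [DFinsupp.finsetSum_apply]
      rw [Finset.sum_eq_single (α, β)]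
      · exact DirectSum.of_eq_same _ _
      · rintro ⟨γ, δ⟩ hmem hne
        rw [Finset.mem_product] at hmem
        refine DirectSum.of_eq_of_ne _ _ _ fun heq => hne ?_
        have h1 : γ ≤ α := Finset.le_max' _ _ hmem.1
        have h2 : δ ≤ β := Finset.le_max' _ _ hmem.2
        have heq : α + β = γ + δ := heq
        rcases h1.lt_or_eq with h1 | rfl
        · exact absurd heq (add_lt_add_of_lt_of_le h1 h2).ne'
        · rw [add_left_cancel heq]
      · intro hnot
        exact absurd (Finset.mem_product.2 ⟨Finset.max'_mem _ hsx, Finset.max'_mem _ hsy⟩) hnot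
    rw [h] at key
    obtain ⟨a, ha, hxa⟩ := GrComp.mk_surj (x α)
    obtain ⟨b, hb, hyb⟩ := GrComp.mk_surj (y β)
    rw [hxa] at hxα
    rw [hyb] at hyβ
    have ha' : ν a = α :=
      le_antisymm (not_lt.1 fun h => hxα (GrComp.mk_eq_zero_iff.2 h)) ha
    have hb' : ν b = β :=
      le_antisymm (not_lt.1 fun h => hyβ (GrComp.mk_eq_zero_iff.2 h)) hb
    rw [hxa, hyb, GrComp.mul_mk_mk] at key
    have := GrComp.mk_eq_zero_iff.1 key.symm
    rw [ν.map_mul, ha', hb', WithTop.coe_add] at this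
    exact lt_irrefl _ this

instance (ν : AddValuation R (WithTop Γ)) : IsDomain (Gr ν) := NoZeroDivisors.to_isDomain _

/-- The map induced on components of degree `γ` by an inequality `ν ≤ μ`. -/
def GrComp.map {ν μ : AddValuation R (WithTop Γ)} (h : ∀ a, ν a ≤ μ a) (γ : Γ) :
    GrComp ν γ →+ GrComp μ γ :=
  QuotientAddGroup.lift _
    (AddMonoidHom.mk' (fun a : levelGe ν γ => GrComp.mk μ γ a.1 (a.2.trans (h a.1)))
      (fun _ _ => rfl))
    (fun a ha => GrComp.mk_eq_zero_iff.2 (lt_of_lt_of_le (show _ < ν a.1 from ha) (h a.1)))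

/-- The homomorphism of graded rings `gr_ν(R) → gr_μ(R)` induced by an inequality `ν ≤ μ`. It maps
`in_ν(a)` to `in_μ(a)` if `ν(a) = μ(a)`, and to `0` if `ν(a) < μ(a)`. -/
def grMap {ν μ : AddValuation R (WithTop Γ)} (h : ∀ a, ν a ≤ μ a) : Gr ν →+* Gr μ :=
  DirectSum.toSemiring (fun γ => (DirectSum.of (GrComp μ) γ).comp (GrComp.map h γ)) rfl
    (by
      intro γ δ x y
      obtain ⟨a, ha, rfl⟩ := GrComp.mk_surj x
      obtain ⟨b, hb, rfl⟩ := GrComp.mk_surj y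
      exact (of_mk_mul_of_mk μ (ha.trans (h a)) (hb.trans (h b))).symm)

theorem grMap_of {ν μ : AddValuation R (WithTop Γ)} (h : ∀ a, ν a ≤ μ a) (γ : Γ)
    (x : GrComp ν γ) : grMap h (DirectSum.of (GrComp ν) γ x) =
      DirectSum.of (GrComp μ) γ (GrComp.map h γ x) :=
  DirectSum.toSemiring_of _ _ _ _ _

theorem grMap_of_mk {ν μ : AddValuation R (WithTop Γ)} (h : ∀ a, ν a ≤ μ a) {γ : Γ} {a : R}
    (ha : (γ : WithTop Γ) ≤ ν a) :
    grMap h (DirectSum.of (GrComp ν) γ (GrComp.mk ν γ a ha)) =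
      DirectSum.of (GrComp μ) γ (GrComp.mk μ γ a (ha.trans (h a))) :=
  DirectSum.toSemiring_of _ _ _ _ _

theorem grMap_of_mk_eq_zero_iff {ν μ : AddValuation R (WithTop Γ)} (h : ∀ a, ν a ≤ μ a) {γ : Γ}
    {a : R} (ha : (γ : WithTop Γ) ≤ ν a) :
    grMap h (DirectSum.of (GrComp ν) γ (GrComp.mk ν γ a ha)) = 0 ↔ (γ : WithTop Γ) < μ a := by
  rw [grMap_of_mk, ← GrComp.mk_eq_zero_iff (ha := ha.trans (h a)),
    ← (DirectSum.of_injective (β := GrComp μ) γ).eq_iff, map_zero]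

theorem grMap_initialForm_eq_zero {ν μ : AddValuation R (WithTop Γ)} (h : ∀ a, ν a ≤ μ a)
    {a : R} (ha : ν a < μ a) : grMap h (initialForm ν a) = 0 := by
  obtain ⟨γ, hγ⟩ := WithTop.ne_top_iff_exists.1 ha.ne_top
  rw [initialForm_eq_of ν hγ.symm, grMap_of_mk_eq_zero_iff, hγ]
  exact ha

theorem grMap_apply {ν μ : AddValuation R (WithTop Γ)} (h : ∀ a, ν a ≤ μ a) (x : Gr ν)
    (γ : Γ) : grMap h x γ = GrComp.map h γ (x γ) := by
  induction x using DirectSum.induction_on with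
  | zero => simp
  | of δ x =>
    rw [grMap_of]
    by_cases hδ : δ = γ
    · subst hδ
      simp [DirectSum.of_eq_same]
    · simp [DirectSum.of_eq_of_ne _ _ _ (Ne.symm hδ)]
  | add x y hx hy => rw [map_add, DirectSum.add_apply, hx, hy, DirectSum.add_apply, map_add]

/-- The kernel of `gr_ν(R) → gr_μ(R)` is generated by the forms `in_ν(a)` with `ν(a) < μ(a)`. -/
theorem mem_of_grMap_eq_zero {ν μ : AddValuation R (WithTop Γ)} (h : ∀ a, ν a ≤ μ a)
    {I : Ideal (Gr ν)} (hI : ∀ a, ν a < μ a → initialForm ν a ∈ I) {x : Gr ν}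
    (hx : grMap h x = 0) : x ∈ I := by
  classical
  rw [← DirectSum.sum_support_of x]
  refine Ideal.sum_mem _ fun γ _ => ?_
  have hγ : GrComp.map h γ (x γ) = 0 := by rw [← grMap_apply, hx]; rfl
  obtain ⟨a, ha, hxa⟩ := GrComp.mk_surj (x γ)
  rw [hxa] at hγ ⊢
  have hμ : (γ : WithTop Γ) < μ a := GrComp.mk_eq_zero_iff.1 hγ
  rcases ha.lt_or_eq with hlt | heq
  · rw [of_mk_of_lt ν hlt]
    exact I.zero_mem
  · rw [← initialForm_eq_of ν heq.symm]
    exact hI a (heq ▸ hμ)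

end GradedRing

/-! ### The Rees ring and Chevalley's extension theorem -/

section Rees

variable {R : Type*} [CommRing R]
variable {Γ : Type*} [AddCommGroup Γ] [LinearOrder Γ] [IsOrderedAddMonoid Γ]

instance (ν : AddValuation R (WithTop Γ)) : SetLike.GradedMonoid (levelGe ν) where
  one_mem := ν.map_one.ge
  mul_mem _ _ _ _ ha hb := mul_mem_levelGe ha hb

/-- The (extended) Rees ring `⨁_γ P_γ` of `ν`. -/
abbrev Rees (ν : AddValuation R (WithTop Γ)) : Type _ := ⨁ γ, levelGe ν γ

/-- The projection `⨁_γ P_γ → ⨁_γ P_γ / P_γ⁺` of the Rees ring onto the graded ring. -/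
def Rees.toGr (ν : AddValuation R (WithTop Γ)) : Rees ν →+* Gr ν :=
  DirectSum.toSemiring
    (fun γ => (DirectSum.of (GrComp ν) γ).comp
      (QuotientAddGroup.mk' ((levelGt ν γ).addSubgroupOf (levelGe ν γ)))) rfl
    (fun a b => (of_mk_mul_of_mk ν a.2 b.2).symm)

theorem Rees.toGr_of (ν : AddValuation R (WithTop Γ)) {γ : Γ} (a : levelGe ν γ) :
    Rees.toGr ν (DirectSum.of (fun γ => levelGe ν γ) γ a) =
      DirectSum.of (GrComp ν) γ (GrComp.mk ν γ a.1 a.2) :=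
  DirectSum.toSemiring_of _ _ _ _ _

variable {L : Type*} [Field L]

/-- The homomorphism from the Rees ring to the group algebra `L[T^Γ]` that maps `a ∈ P_γ` to
`q(a) T^γ`. -/
def Rees.toGroupAlgebra (ν : AddValuation R (WithTop Γ)) (q : R →+* L) :
    Rees ν →+* AddMonoidAlgebra L Γ :=
  DirectSum.toSemiring
    (fun γ => (AddMonoidAlgebra.singleAddHom γ).comp
      (q.toAddMonoidHom.comp (levelGe ν γ).subtype))
    (by
      change AddMonoidAlgebra.single 0 (q 1) = 1
      rw [map_one]; rfl)
    (fun {γ δ} a b => by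
      change AddMonoidAlgebra.single (γ + δ) (q (a.1 * b.1)) =
        AddMonoidAlgebra.single γ (q a.1) * AddMonoidAlgebra.single δ (q b.1)
      rw [AddMonoidAlgebra.single_mul_single, map_mul])

theorem Rees.toGroupAlgebra_of (ν : AddValuation R (WithTop Γ)) (q : R →+* L) {γ : Γ}
    (a : levelGe ν γ) :
    Rees.toGroupAlgebra ν q (DirectSum.of (fun γ => levelGe ν γ) γ a) =
      AddMonoidAlgebra.single γ (q a.1) :=
  DirectSum.toSemiring_of _ _ _ _ _

theorem Rees.toGroupAlgebra_apply (ν : AddValuation R (WithTop Γ)) (q : R →+* L) (x : Rees ν)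
    (γ : Γ) : (Rees.toGroupAlgebra ν q x).coeff γ = q (x γ).1 := by
  induction x using DirectSum.induction_on with
  | zero => simp
  | of δ a =>
    rw [Rees.toGroupAlgebra_of]
    by_cases h : δ = γ
    · subst h
      simp [DirectSum.of_eq_same]
    · simp [DirectSum.of_eq_of_ne _ _ _ (Ne.symm h), h]
  | add x y hx hy => simp [hx, hy]

/-- The kernel of the map to `L[T^Γ]` is sent into `I` by the projection to the graded ring, since
its elements have components in the kernel of `q`. -/
theorem Rees.toGr_mem_of_toGroupAlgebra_eq_zero (ν : AddValuation R (WithTop Γ)) (q : R →+* L)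
    {I : Ideal (Gr ν)} (hq : ∀ a, q a = 0 → initialForm ν a ∈ I) {x : Rees ν}
    (hx : Rees.toGroupAlgebra ν q x = 0) : Rees.toGr ν x ∈ I := by
  classical
  rw [← DirectSum.sum_support_of x, map_sum]
  refine Ideal.sum_mem _ fun γ _ => ?_
  have hγ : q (x γ).1 = 0 := by rw [← Rees.toGroupAlgebra_apply, hx]; rfl
  rw [Rees.toGr_of]
  rcases (show (γ : WithTop Γ) ≤ ν (x γ).1 from (x γ).2).lt_or_eq with hlt | heq
  · rw [of_mk_of_lt ν hlt]
    exact I.zero_mem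
  · rw [← initialForm_eq_of ν heq.symm]
    exact hq _ hγ

/-- Chevalley's extension theorem for the Rees ring: a proper ideal `I` of the graded ring that
contains the initial forms of the kernel of `q` is dominated by a valuation of the field of fractions
of `L[T^Γ]`. Restricting it to `L` gives `w`, and its values at `T^{-γ}` give `θ`. -/
theorem exists_valuation_of_ideal (ν : AddValuation R (WithTop Γ)) (q : R →+* L)
    {I : Ideal (Gr ν)} (hI : I ≠ ⊤) (hq : ∀ a, q a = 0 → initialForm ν a ∈ I) :
    ∃ (V : ValuationSubring (FractionRing (AddMonoidAlgebra L Γ)))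
      (w : Valuation L V.ValueGroup) (θ : Multiplicative Γ →* V.ValueGroup),
      StrictAnti (fun γ : Γ => θ (Multiplicative.ofAdd γ)) ∧
      (∀ γ, θ γ ≠ 0) ∧
      (∀ (γ : Γ) (a : R), (γ : WithTop Γ) ≤ ν a → w (q a) ≤ θ (Multiplicative.ofAdd γ)) ∧
      (∀ (γ : Γ) (a : R) (ha : (γ : WithTop Γ) ≤ ν a),
        DirectSum.of (GrComp ν) γ (GrComp.mk ν γ a ha) ∈ I →
        w (q a) < θ (Multiplicative.ofAdd γ)) := by
  set E := FractionRing (AddMonoidAlgebra L Γ)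
  let σ : Rees ν →+* E := (algebraMap (AddMonoidAlgebra L Γ) E).comp (Rees.toGroupAlgebra ν q)
  have hinj : Function.Injective (algebraMap (AddMonoidAlgebra L Γ) E) :=
    IsFractionRing.injective _ _
  let J : Ideal σ.range := (I.comap (Rees.toGr ν)).map σ.rangeRestrict
  have hJ : J ≠ ⊤ := by
    intro h
    have h1 : (1 : σ.range) ∈ J := h ▸ Submodule.mem_top
    obtain ⟨x, hx, hx1⟩ :=
      (Ideal.mem_map_iff_of_surjective _ σ.rangeRestrict_surjective).1 h1
    have h0 : Rees.toGroupAlgebra ν q (1 - x) = 0 := by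
      apply hinj
      rw [map_zero]
      change σ (1 - x) = 0
      rw [map_sub, map_one, sub_eq_zero]
      exact (congrArg Subtype.val hx1).symm
    have h2 := Rees.toGr_mem_of_toGroupAlgebra_eq_zero ν q hq h0
    apply hI
    rw [Ideal.eq_top_iff_one]
    have h3 := I.add_mem h2 (Ideal.mem_comap.1 hx)
    rwa [← map_add, sub_add_cancel, map_one] at h3
  obtain ⟨V, hV, hVJ⟩ := Ideal.image_subset_nonunits_valuationSubring J hJ
  let T : Γ → E := fun γ => algebraMap (AddMonoidAlgebra L Γ) E (AddMonoidAlgebra.single γ 1)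
  let ι : L →+* E := (algebraMap (AddMonoidAlgebra L Γ) E).comp AddMonoidAlgebra.singleZeroRingHom
  have hT0 : T 0 = 1 := map_one _
  have hTadd (γ δ : Γ) : T (γ + δ) = T γ * T δ := by
    simp only [T]
    rw [← map_mul, AddMonoidAlgebra.single_mul_single, one_mul]
  have hσ (γ : Γ) (a : R) (ha : (γ : WithTop Γ) ≤ ν a) :
      σ (DirectSum.of (fun γ => levelGe ν γ) γ ⟨a, ha⟩) = ι (q a) * T γ := by
    simp only [σ, ι, T, RingHom.comp_apply]
    rw [Rees.toGroupAlgebra_of, ← map_mul]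
    congr 1
    change _ = AddMonoidAlgebra.single 0 (q a) * _
    rw [AddMonoidAlgebra.single_mul_single, zero_add, mul_one]
  have hle (γ : Γ) (a : R) (ha : (γ : WithTop Γ) ≤ ν a) :
      V.valuation (ι (q a) * T γ) ≤ 1 := by
    rw [ValuationSubring.valuation_le_one_iff, ← hσ γ a ha]
    exact hV ⟨_, rfl⟩
  have hlt (γ : Γ) (a : R) (ha : (γ : WithTop Γ) ≤ ν a)
      (hI : DirectSum.of (GrComp ν) γ (GrComp.mk ν γ a ha) ∈ I) :
      V.valuation (ι (q a) * T γ) < 1 := by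
    rw [← ValuationSubring.mem_nonunits_iff, ← hσ γ a ha]
    refine hVJ ⟨⟨_, ⟨_, rfl⟩⟩, ?_, rfl⟩
    refine Ideal.mem_map_of_mem σ.rangeRestrict ?_
    rw [Ideal.mem_comap, Rees.toGr_of]
    exact hI
  have hTinv (γ : Γ) : V.valuation (T γ) * V.valuation (T (-γ)) = 1 := by
    rw [← map_mul, ← hTadd, add_neg_cancel, hT0, map_one]
  let θ : Multiplicative Γ →* V.ValueGroup :=
    { toFun := fun γ => V.valuation (T (-γ.toAdd))
      map_one' := by simp [hT0]
      map_mul' := fun γ δ => by rw [← map_mul, ← hTadd, toAdd_mul, neg_add] }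
  have hθT (γ : Γ) : θ (Multiplicative.ofAdd γ) * V.valuation (T γ) = 1 := by
    rw [mul_comm]; exact hTinv γ
  have hθ0 (γ) : θ γ ≠ 0 := left_ne_zero_of_mul_eq_one (hθT γ.toAdd)
  have hTpos (γ : Γ) : 0 < V.valuation (T γ) :=
    zero_lt_iff.2 (right_ne_zero_of_mul_eq_one (hθT γ))
  refine ⟨V, V.valuation.comap ι, θ, ?_, hθ0, ?_, ?_⟩
  · intro γ δ hγδ
    -- for `γ < δ` the element `T^(γ - δ)` is the image of `1 ∈ P_{γ - δ}`, whose class vanishes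
    have h1 : ((γ - δ : Γ) : WithTop Γ) < ν 1 := by
      rw [ν.map_one]
      exact_mod_cast sub_neg.2 hγδ
    have h2 := hlt (γ - δ) 1 h1.le (by rw [of_mk_of_lt ν h1]; exact I.zero_mem)
    rw [map_one, map_one, one_mul, sub_eq_add_neg, hTadd, map_mul] at h2
    have h3 : θ (Multiplicative.ofAdd δ) = V.valuation (T (-δ)) := rfl
    rw [← h3] at h2
    have h4 := mul_lt_mul_of_pos_left h2 (zero_lt_iff.2 (hθ0 (Multiplicative.ofAdd γ)))
    rwa [← mul_assoc, hθT, one_mul, mul_one] at h4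
  · intro γ a ha
    have h2 := hle γ a ha
    rw [map_mul, ← hθT γ] at h2
    exact le_of_mul_le_mul_right h2 (hTpos γ)
  · intro γ a ha hI
    have h2 := hlt γ a ha hI
    rw [map_mul, ← hθT γ] at h2
    exact lt_of_mul_lt_mul_right h2 (hTpos γ).le

end Rees

/-! ### Additive valuations from multiplicative ones -/

section Values

variable {Γ : Type*} [AddCommGroup Γ]
variable {L : Type*} [Field L] {G : Type*} [LinearOrderedCommGroupWithZero G]

/-- A multiplicative valuation all of whose nonzero values lie in the image of an
order-reversing embedding `θ` of `Γ` is an additive valuation with values in `Γ_∞`. -/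
theorem exists_addValuation_of_range [LinearOrder Γ] [IsOrderedAddMonoid Γ]
    (w : Valuation L G) (θ : Multiplicative Γ →* G)
    (hθ : StrictAnti (fun γ : Γ => θ (Multiplicative.ofAdd γ)))
    (hw : ∀ y : L, y ≠ 0 → ∃ γ : Γ, w y = θ (Multiplicative.ofAdd γ)) :
    ∃ m : AddValuation L (WithTop Γ),
      (∀ (y : L) (γ : Γ), (γ : WithTop Γ) ≤ m y ↔ w y ≤ θ (Multiplicative.ofAdd γ)) ∧
      ∀ (y : L) (γ : Γ), w y < θ (Multiplicative.ofAdd γ) → (γ : WithTop Γ) < m y := by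
  classical
  choose! val hval using hw
  let m : L → WithTop Γ := fun y => if y = 0 then ⊤ else (val y : WithTop Γ)
  have hm (y : L) (γ : Γ) : (γ : WithTop Γ) ≤ m y ↔ w y ≤ θ (Multiplicative.ofAdd γ) := by
    by_cases hy : y = 0
    · simp [m, hy]
    · simp only [m, hy, if_false, WithTop.coe_le_coe]
      rw [hval y hy]
      exact hθ.le_iff_ge.symm
  refine ⟨AddValuation.of m (by simp [m]) ?_ ?_ ?_, hm, fun y γ hγ => ?_⟩
  · simp only [m, one_ne_zero, if_false]
    have : val 1 = 0 := hθ.injective (by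
      rw [← hval 1 one_ne_zero, map_one, ofAdd_zero, map_one])
    rw [this]; rfl
  · intro x y
    by_cases hx : x = 0
    · simp [hx]
    by_cases hy : y = 0
    · simp [hy]
    obtain ⟨γ, hγ⟩ : ∃ γ : Γ, (γ : WithTop Γ) = min (m x) (m y) :=
      WithTop.ne_top_iff_exists.1 (by simp [m, hx, hy])
    rw [← hγ, hm]
    have hγ := hγ.le
    rw [le_min_iff, hm, hm] at hγ
    exact (w.map_add x y).trans (max_le hγ.1 hγ.2)
  · intro x y
    by_cases hx : x = 0
    · simp [m, hx]
    by_cases hy : y = 0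
    · simp [m, hy]
    simp only [m, hx, hy, mul_ne_zero hx hy, if_false]
    rw [← WithTop.coe_add, WithTop.coe_inj]
    apply hθ.injective
    change θ (Multiplicative.ofAdd (val (x * y))) = θ (Multiplicative.ofAdd (val x + val y))
    rw [← hval _ (mul_ne_zero hx hy), ofAdd_add, map_mul, map_mul, hval x hx, hval y hy]
  · change (γ : WithTop Γ) < m y
    by_cases hy : y = 0
    · simp [m, hy]
    · simp only [m, hy, if_false, WithTop.coe_lt_coe]
      rw [hval y hy] at hγ
      exact hθ.lt_iff_gt.1 hγ

/-- In a vanishing sum of nonzero terms, two of the terms have the same value. -/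
theorem exists_ne_map_eq_of_sum_eq_zero {ι : Type*} (w : Valuation L G) {s : Finset ι}
    {f : ι → L} (hs : s.Nonempty) (hf : ∀ i ∈ s, f i ≠ 0) (h : ∑ i ∈ s, f i = 0) :
    ∃ i ∈ s, ∃ j ∈ s, i ≠ j ∧ w (f i) = w (f j) := by
  classical
  by_contra! hcon
  obtain ⟨i, hi, hmax⟩ := s.exists_max_image (fun i => w (f i)) hs
  have := w.map_sum_eq_of_lt (f := f) (s := s) (j := i) hi
    (fun j hj => by
      rw [Finset.mem_sdiff, Finset.mem_singleton] at hj
      exact lt_of_le_of_ne (hmax j hj.1) (hcon j hj.1 i hi hj.2))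
  rw [h, map_zero] at this
  exact (w.ne_zero_iff).2 (hf i hi) this.symm

/-- The values of a valuation on an algebraic extension lie in the divisible hull of the values on
the base field, hence in the image of `θ` if `Γ` is divisible. -/
theorem exists_map_eq_of_isAlgebraic {K : Type*} [Field K] [Algebra K L]
    (hΓ : ∀ (m : ℕ), m ≠ 0 → ∀ γ : Γ, ∃ δ : Γ, m • δ = γ)
    (w : Valuation L G) (θ : Multiplicative Γ →* G)
    (hw : ∀ c : K, c ≠ 0 → ∃ γ : Γ, w (algebraMap K L c) = θ (Multiplicative.ofAdd γ))
    {y : L} (hy : y ≠ 0) (hal : IsAlgebraic K y) :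
    ∃ γ : Γ, w y = θ (Multiplicative.ofAdd γ) := by
  obtain ⟨P, hP, hPy⟩ := hal
  rw [aeval_eq_sum_range' (Nat.lt_succ_self _), ← Finset.sum_subset
    (P.supp_subset_range_natDegree_succ) (fun i _ hi => by simp [notMem_support_iff.1 hi])] at hPy
  obtain ⟨i, hi, j, hj, hij, heq⟩ := exists_ne_map_eq_of_sum_eq_zero w
    (support_nonempty.2 hP) (fun i hi => smul_ne_zero (mem_support_iff.1 hi) (pow_ne_zero i hy)) hPy
  wlog hlt : i < j generalizing i j
  · exact this j hj i hi hij.symm heq.symm (lt_of_le_of_ne (not_lt.1 hlt) hij.symm)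
  obtain ⟨γ, hγ⟩ := hw _ (mem_support_iff.1 hi)
  obtain ⟨δ, hδ⟩ := hw _ (mem_support_iff.1 hj)
  obtain ⟨k, rfl⟩ := Nat.exists_eq_add_of_lt hlt
  obtain ⟨ε, hε⟩ := hΓ (k + 1) (Nat.succ_ne_zero k) (γ - δ)
  refine ⟨ε, ?_⟩
  have hwy : w y ≠ 0 := w.ne_zero_iff.2 hy
  have hδ0 : w (algebraMap K L (P.coeff (i + k + 1))) ≠ 0 :=
    w.ne_zero_iff.2 (by simpa using mem_support_iff.1 hj)
  rw [Algebra.smul_def, Algebra.smul_def, map_mul, map_mul, map_pow, map_pow, hγ, hδ, add_assoc,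
    pow_add, mul_left_comm, mul_comm] at heq
  have h1 := mul_left_cancel₀ (pow_ne_zero i hwy) heq
  have h2 : θ (Multiplicative.ofAdd ε) ^ (k + 1) = w y ^ (k + 1) := by
    rw [hδ] at hδ0
    apply mul_left_cancel₀ hδ0
    rw [← h1, ← map_pow, ← map_mul, ← ofAdd_nsmul, hε, ← ofAdd_add, add_sub_cancel]
  exact ((pow_left_inj₀ zero_le zero_le (Nat.succ_ne_zero k)).1 h2).symm

end Values

/-! ### Valuations of the polynomial ring above a given one -/

section Comparison

variable {R : Type*} [CommRing R]
variable {Γ : Type*} [AddCommGroup Γ] [LinearOrder Γ] [IsOrderedAddMonoid Γ]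

/-- If `ν ≤ μ` agree at a product `ab` of finite value, they agree at each factor. -/
theorem map_le_of_mul_le {ν μ : AddValuation R (WithTop Γ)} (h : ∀ a, ν a ≤ μ a) {a b : R}
    (hab : μ (a * b) ≤ ν (a * b)) (htop : ν (a * b) ≠ ⊤) : μ a ≤ ν a := by
  have hb := h b
  rw [μ.map_mul, ν.map_mul] at hab
  rw [ν.map_mul, WithTop.add_ne_top] at htop
  by_contra! hlt
  exact absurd hab (not_le.2 (WithTop.add_lt_add_of_lt_of_le htop.2 hlt hb))

end Comparison

variable {K : Type*} [Field K]
variable {Γ : Type*} [AddCommGroup Γ] [LinearOrder Γ] [IsOrderedAddMonoid Γ]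
variable {ν₀ : AddValuation K (WithTop Γ)}

/-- A valuation with nonzero support `(p)` is maximal: it is a valuation of the field
`K[x]/(p)`, and comparable valuations of a field are equal. -/
theorem eq_zero_of_not_isMax {ν : Ext ν₀} (hmax : ¬ IsMax (ν : 𝒱 ν₀)) {f : K[X]}
    (hf : ν.1 f = ⊤) : f = 0 := by
  by_contra hf0
  have hbot : ν.1.supp ≠ ⊥ := fun h => hf0 (by
    rw [← Ideal.mem_bot, ← h, AddValuation.mem_supp_iff]; exact hf)
  have hprime : ν.1.supp.IsPrime := by
    refine ⟨fun h => ?_, fun {a b} hab => ?_⟩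
    · have h1 := h ▸ Submodule.mem_top (R := K[X]) (x := (1 : K[X]))
      rw [AddValuation.mem_supp_iff, ν.1.map_one] at h1
      exact WithTop.zero_ne_top h1
    · simpa only [AddValuation.mem_supp_iff, ν.1.map_mul, WithTop.add_eq_top] using hab
  have hM : ν.1.supp.IsMaximal := IsPrime.to_maximal_ideal hbot
  refine hmax fun b hb => ?_
  induction b using WithBot.recBotCoe with
  | bot => exact bot_le
  | coe m =>
    have hle : ∀ f, ν.1 f ≤ m.1 f := WithBot.coe_le_coe.1 hb
    refine WithBot.coe_le_coe.2 fun f => ?_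
    by_cases hf : f ∈ ν.1.supp
    · rw [(AddValuation.mem_supp_iff _ _).1 hf]
      exact le_top
    · obtain ⟨y, i, hi, hy⟩ := hM.exists_inv hf
      rw [AddValuation.mem_supp_iff] at hi
      have key (v : AddValuation K[X] (WithTop Γ)) (hv : v i = ⊤) : v (f * y) = 0 := by
        rw [mul_comm, eq_sub_of_add_eq hy, sub_eq_add_neg, ← v.map_one]
        apply v.map_add_eq_of_lt_left
        rw [v.map_neg, hv, v.map_one]
        exact WithTop.coe_lt_top 0
      have h1 := key ν.1 hi
      have h2 := key m.1 (top_le_iff.1 (hi ▸ hle i))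
      exact map_le_of_mul_le hle (h2.trans h1.symm).le (by rw [h1]; exact WithTop.coe_ne_top)

/-- The homogeneous elements of a proper ideal of `gr_ν(K[x])` containing `in_ν(p)` lie in the kernel
of the map to `gr_μ(K[x])` for some valuation `μ ≥ ν` with support `(p)`. The value group of the
Chevalley valuation is brought back into `Γ` by divisibility. -/
theorem exists_ext_of_irreducible (hΓ : ∀ (m : ℕ), m ≠ 0 → ∀ γ : Γ, ∃ δ : Γ, m • δ = γ)
    {ν : Ext ν₀} (hν : ∀ f, ν.1 f = ⊤ → f = 0) {p : K[X]} (hp : Irreducible p)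
    {I : Ideal (Gr ν.1)} (hI : I ≠ ⊤) (hpI : initialForm ν.1 p ∈ I) :
    ∃ (μ : Ext ν₀) (h : ν ≤ μ), μ.1.supp = Ideal.span {p} ∧
      ∀ φ : Gr ν.1, IsHomogeneous ν.1 φ → φ ∈ I → grMap h φ = 0 := by
  have : Fact (Irreducible p) := ⟨hp⟩
  have hfin : FiniteDimensional K (AdjoinRoot p) :=
    (AdjoinRoot.powerBasis hp.ne_zero).finite
  have hker (f : K[X]) : AdjoinRoot.mk p f = 0 ↔ p ∣ f := AdjoinRoot.mk_eq_zero
  obtain ⟨V, w, θ, hθ, hθ0, hle, hlt⟩ := exists_valuation_of_ideal ν.1 (AdjoinRoot.mk p) hI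
    (fun f hf => by
      obtain ⟨g, rfl⟩ := (hker f).1 hf
      rw [initialForm_mul]
      exact I.mul_mem_right _ hpI)
  -- `c T^γ` with `γ = ν₀(c)` and its inverse both come from the Rees ring
  have hK (c : K) (hc : c ≠ 0) :
      ∃ γ : Γ, w (algebraMap K (AdjoinRoot p) c) = θ (Multiplicative.ofAdd γ) := by
    obtain ⟨γ, hγ⟩ := WithTop.ne_top_iff_exists.1 (mt ν₀.top_iff.1 hc)
    refine ⟨γ, ?_⟩
    have hγ' : ν₀ c⁻¹ = ((-γ : Γ) : WithTop Γ) := by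
      rw [ν₀.map_inv, ← hγ]; rfl
    have h1 : w (algebraMap K (AdjoinRoot p) c) ≤ θ (Multiplicative.ofAdd γ) :=
      hle γ (C c) (by rw [ν.2, hγ])
    have h2 : w (algebraMap K (AdjoinRoot p) c⁻¹) ≤ θ (Multiplicative.ofAdd (-γ)) :=
      hle (-γ) (C c⁻¹) (by rw [ν.2, hγ'])
    refine le_antisymm h1 ?_
    rw [map_inv₀, map_inv₀] at h2
    have hθγ : θ (Multiplicative.ofAdd γ) * θ (Multiplicative.ofAdd (-γ)) = 1 := by
      rw [← map_mul, ← ofAdd_add, add_neg_cancel, ofAdd_zero, map_one]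
    have hpos : 0 < w (algebraMap K (AdjoinRoot p) c) :=
      zero_lt_iff.2 (w.ne_zero_iff.2 (by simpa using hc))
    rw [inv_le_iff_one_le_mul₀ hpos, ← hθγ] at h2
    rw [mul_comm] at h2
    exact le_of_mul_le_mul_left h2 (zero_lt_iff.2 (hθ0 _))
  obtain ⟨m, hm, hm'⟩ := exists_addValuation_of_range w θ hθ (fun y hy =>
    exists_map_eq_of_isAlgebraic hΓ w θ hK hy (Algebra.IsAlgebraic.isAlgebraic y))
  let μ : AddValuation K[X] (WithTop Γ) := m.comap (AdjoinRoot.mk p)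
  have hμ (f : K[X]) : μ f = m (AdjoinRoot.mk p f) := rfl
  have hνμ (f : K[X]) : ν.1 f ≤ μ f := by
    by_cases hf : ν.1 f = ⊤
    · simp [hν f hf]
    · obtain ⟨γ, hγ⟩ := WithTop.ne_top_iff_exists.1 hf
      rw [← hγ, hμ, hm]
      exact hle γ f hγ.le
  have hμC (c : K) : μ (C c) = ν₀ c := by
    by_cases hc : c = 0
    · simp [hc]
    have h1 (v : AddValuation K[X] (WithTop Γ)) : v (C c * C c⁻¹) = 0 := by
      rw [← C_mul, mul_inv_cancel₀ hc, C_1, v.map_one]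
    rw [← ν.2]
    exact le_antisymm (map_le_of_mul_le hνμ (by rw [h1, h1])
      (by rw [h1]; exact WithTop.coe_ne_top)) (hνμ _)
  refine ⟨⟨μ, hμC⟩, hνμ, ?_, ?_⟩
  · ext f
    rw [AddValuation.mem_supp_iff, Ideal.mem_span_singleton, ← hker, ← m.top_iff]
    rfl
  · rintro _ ⟨γ, x, rfl⟩ hφ
    obtain ⟨a, ha, rfl⟩ := GrComp.mk_surj x
    rw [grMap_of_mk_eq_zero_iff]
    change _ < μ a
    exact hm' _ _ (hlt γ a ha hφ)

/-- If `g` has minimal degree among the polynomials with `ν(g) < μ(g)`, division by `g` shows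
that the kernel of `gr_ν(K[x]) → gr_μ(K[x])` is generated by `in_ν(g)`. -/
theorem exists_prime_initialForm {ν μ : AddValuation K[X] (WithTop Γ)} (h : ∀ f, ν f ≤ μ f)
    (hlt : ∃ f, ν f < μ f) :
    ∃ g, ν g < μ g ∧ Prime (initialForm ν g) ∧
      (∀ f, ν f < μ f → initialForm ν f = initialForm ν (f / g) * initialForm ν g) ∧
      ∀ x : Gr ν, grMap h x = 0 → initialForm ν g ∣ x := by
  obtain ⟨g, hg, hmin⟩ := WellFounded.has_min (measure (natDegree (R := K))).wf
    {f | ν f < μ f} hlt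
  have hg : ν g < μ g := hg
  have hg0 : g ≠ 0 := by
    rintro rfl
    simp at hg
  have hdiv (f) (hf : ν f < μ f) :
      initialForm ν f = initialForm ν (f / g) * initialForm ν g := by
    -- minimality of the degree of `g`
    have hr : μ (f % g) ≤ ν (f % g) := by
      by_cases hr0 : f % g = 0
      · simp [hr0]
      · exact not_lt.1 fun hlt =>
          hmin _ hlt (natDegree_lt_natDegree hr0 (EuclideanDomain.mod_lt f hg0))
    have hfgr : g * (f / g) = f - f % g := by
      rw [eq_sub_iff_add_eq, EuclideanDomain.div_add_mod]
    rw [← initialForm_mul, mul_comm]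
    refine initialForm_congr ν ?_
    rw [hfgr, sub_sub_cancel_left, ν.map_neg]
    by_contra! hcon
    -- otherwise `ν` and `μ` agree at `g * (f / g)`, hence at `g`
    have hμr : μ (f % g) < μ f := (hr.trans hcon).trans_lt hf
    have h1 : μ (g * (f / g)) = μ (f % g) := by
      rw [hfgr, μ.map_sub_swap, sub_eq_add_neg]
      apply μ.map_add_eq_of_lt_left
      rwa [μ.map_neg]
    have h2 : ν (f % g) ≤ ν (g * (f / g)) := by
      rw [hfgr]
      exact ν.map_le_sub hcon le_rfl
    have h3 : μ (g * (f / g)) ≤ ν (g * (f / g)) := h1.le.trans (hr.trans h2)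
    have h4 : ν (g * (f / g)) ≠ ⊤ := ((h _).trans_lt (h1.trans_lt hμr).lt_top).ne
    exact absurd (map_le_of_mul_le h h3 h4) hg.not_ge
  have hker : RingHom.ker (grMap h) = Ideal.span {initialForm ν g} := by
    refine le_antisymm (fun x hx => ?_) ?_
    · refine mem_of_grMap_eq_zero h (fun f hf => ?_) hx
      rw [hdiv f hf]
      exact Ideal.mul_mem_left _ _ (Ideal.mem_span_singleton_self _)
    · rw [Ideal.span_singleton_le_iff_mem]
      exact grMap_initialForm_eq_zero h hg
  refine ⟨g, hg, ?_, hdiv, fun x hx => ?_⟩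
  · rw [← Ideal.span_singleton_prime (initialForm_ne_zero ν hg.ne_top), ← hker]
    exact RingHom.ker_isPrime _
  · rw [← Ideal.mem_span_singleton, ← hker]
    exact hx

theorem isHomogeneous_initialForm {R : Type*} [CommRing R] (ν : AddValuation R (WithTop Γ))
    (a : R) : IsHomogeneous ν (initialForm ν a) := by
  by_cases h : ν a = ⊤
  · exact ⟨0, 0, by rw [initialForm_of_eq_top ν h, map_zero]⟩
  · obtain ⟨γ, hγ⟩ := WithTop.ne_top_iff_exists.1 h
    exact ⟨γ, _, initialForm_eq_of ν hγ.symm⟩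

/-- A homogeneous prime factor can be merged into a factorization: it is absorbed by the factor
associated with it, if there is one, and is a new factor otherwise. -/
theorem IsInitialFactorization.exists_mul {ν : AddValuation K[X] (WithTop Γ)} {f g k : K[X]}
    {n : ℕ} {u : Gr ν} {φ : Fin n → Gr ν} {r : Fin n → ℕ}
    (hk : IsInitialFactorization ν k n u φ r) (hg : Prime (initialForm ν g))
    (hf : initialForm ν f = initialForm ν k * initialForm ν g) :
    ∃ (n : ℕ) (u : Gr ν) (φ : Fin n → Gr ν) (r : Fin n → ℕ),
      IsInitialFactorization ν f n u φ r := by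
  by_cases hdvd : ∃ i, initialForm ν g ∣ φ i
  · obtain ⟨i, c, hc⟩ := hdvd
    obtain ⟨c, rfl⟩ := ((hk.irreducible i).isUnit_or_isUnit hc).resolve_left hg.not_isUnit
    refine ⟨n, u * ↑c⁻¹, φ, Function.update r i (r i + 1), hk.isUnit.mul c⁻¹.isUnit,
      hk.homogeneous, hk.irreducible, hk.not_dvd, fun j => ?_, ?_⟩
    · by_cases hj : j = i
      · subst hj; simp
      · simpa [hj] using hk.pos j
    · have hprod : ∏ j, φ j ^ Function.update r i (r i + 1) j = (∏ j, φ j ^ r j) * φ i := by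
        rw [← Finset.mul_prod_erase _ _ (Finset.mem_univ i),
          ← Finset.mul_prod_erase _ (fun j => φ j ^ r j) (Finset.mem_univ i),
          Function.update_self, pow_succ, mul_right_comm]
        congr 2
        refine Finset.prod_congr rfl fun j hj => ?_
        rw [Function.update_of_ne (Finset.ne_of_mem_erase hj)]
      rw [hf, hk.eq, hprod, hc]
      have hcc : (↑c⁻¹ : Gr ν) * ↑c = 1 := c.inv_mul
      linear_combination (-(u * (∏ j, φ j ^ r j) * initialForm ν g)) * hcc
  · push Not at hdvd
    refine ⟨n + 1, u, Fin.cons (initialForm ν g) φ, Fin.cons 1 r, hk.isUnit, ?_, ?_, ?_, ?_, ?_⟩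
    · exact Fin.cases (isHomogeneous_initialForm ν g) hk.homogeneous
    · exact Fin.cases hg.irreducible hk.irreducible
    · refine Fin.cases (Fin.cases ?_ ?_) (fun i => Fin.cases ?_ ?_)
      · exact fun h => absurd rfl h
      · exact fun j _ => hdvd j
      · exact fun _ h => hdvd i
          (((hk.irreducible i).dvd_irreducible_iff_associated hg.irreducible).1 h).dvd'
      · exact fun j hij => hk.not_dvd i j fun h => hij (by rw [h])
    · exact Fin.cases le_rfl hk.pos
    · rw [hf, hk.eq, Fin.prod_univ_succ]
      simp only [Fin.cons_zero, Fin.cons_succ, pow_one]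
      ring

/-- Initial forms factor: a non-unit `in_ν(f)` is divisible by some prime `in_ν(g)` with
nonconstant `g`, and the cofactor is `in_ν(f / g)`, where `f / g` has smaller degree. -/
theorem exists_isInitialFactorization (hΓ : ∀ (m : ℕ), m ≠ 0 → ∀ γ : Γ, ∃ δ : Γ, m • δ = γ)
    {ν : Ext ν₀} (hν : ∀ f, ν.1 f = ⊤ → f = 0) {f : K[X]} (hf : f ≠ 0) :
    ∃ (n : ℕ) (u : Gr ν.1) (φ : Fin n → Gr ν.1) (r : Fin n → ℕ),
      IsInitialFactorization ν.1 f n u φ r := by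
  induction hd : f.natDegree using Nat.strong_induction_on generalizing f with
  | _ d ih =>
  subst hd
  by_cases hu : IsUnit (initialForm ν.1 f)
  · exact ⟨0, initialForm ν.1 f, Fin.elim0, Fin.elim0, hu, fun i => i.elim0, fun i => i.elim0,
      fun i => i.elim0, fun i => i.elim0, by simp⟩
  obtain ⟨p, hp, hpf, hpu⟩ : ∃ p, Irreducible p ∧ p ∣ f ∧ ¬ IsUnit (initialForm ν.1 p) := by
    by_contra! hall
    apply hu
    clear hu ih
    induction f using WfDvdMonoid.induction_on_irreducible with
    | zero => exact absurd rfl hf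
    | unit f hfu =>
      obtain ⟨k, hk⟩ := hfu.exists_right_inv
      refine IsUnit.of_mul_eq_one (initialForm ν.1 k) ?_
      rw [← initialForm_mul, hk, initialForm_one]
    | mul f p hf0 hp ih =>
      rw [initialForm_mul]
      exact (hall p hp (dvd_mul_right _ _)).mul
        (ih hf0 fun q hq hqf => hall q hq (hqf.mul_left _))
  obtain ⟨μ, hμ, hsupp, -⟩ := exists_ext_of_irreducible hΓ hν hp
    (I := Ideal.span {initialForm ν.1 p}) (by rwa [Ne, Ideal.span_singleton_eq_top])
    (Ideal.mem_span_singleton_self _)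
  have hμf : ν.1 f < μ.1 f := by
    have : f ∈ μ.1.supp := by rw [hsupp, Ideal.mem_span_singleton]; exact hpf
    rw [(AddValuation.mem_supp_iff _ _).1 this]
    exact lt_top_iff_ne_top.2 (mt (hν f) hf)
  obtain ⟨g, hg, hgp, hdiv, -⟩ := exists_prime_initialForm hμ ⟨f, hμf⟩
  have hgdeg : 0 < g.degree := by
    by_contra! hle
    rw [eq_C_of_degree_le_zero hle, ν.2, μ.2] at hg
    exact lt_irrefl _ hg
  have hfg := hdiv f hμf
  have hfg0 : f / g ≠ 0 := by
    intro h0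
    rw [h0, initialForm_of_eq_top ν.1 ν.1.map_zero, zero_mul] at hfg
    exact initialForm_ne_zero ν.1 hμf.ne_top hfg
  obtain ⟨n, u, φ, r, hk⟩ := ih _
    (natDegree_lt_natDegree hfg0 (degree_div_lt hf hgdeg)) hfg0 rfl
  exact hk.exists_mul hgp hfg

end ApproachF

end

theorem theorem1p3 {K : Type*} [Field K]
    {Γ : Type*} [AddCommGroup Γ] [LinearOrder Γ] [IsOrderedAddMonoid Γ]
    (hΓ : ∀ (m : ℕ), m ≠ 0 → ∀ γ : Γ, ∃ δ : Γ, m • δ = γ)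
    (ν₀ : AddValuation K (WithTop Γ))
    (F : Polynomial K) (hF : F.Monic) (hF' : Irreducible F)
    (ν : ApproachF.Ext ν₀)
    (hν : (ν : ApproachF.𝒱 ν₀) ∈ ApproachF.VApproach ν₀ F)
    (hmax : ¬ IsMax (ν : ApproachF.𝒱 ν₀)) :
    (∃ (n : ℕ) (u : ApproachF.Gr ν.1) (φ : Fin n → ApproachF.Gr ν.1) (r : Fin n → ℕ),
      ApproachF.IsInitialFactorization ν.1 F n u φ r) ∧
    ∀ (n : ℕ) (u : ApproachF.Gr ν.1) (φ : Fin n → ApproachF.Gr ν.1) (r : Fin n → ℕ),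
      ApproachF.IsInitialFactorization ν.1 F n u φ r →
      ∃ μ : Fin n → ApproachF.𝒱 ν₀,
        Function.Injective μ ∧
        ∀ i, μ i ∈ ApproachF.VSupp ν₀ F ∧ (ν : ApproachF.𝒱 ν₀) < μ i := by
  have hsupp (f : Polynomial K) (hf : ν.1 f = ⊤) : f = 0 :=
    ApproachF.eq_zero_of_not_isMax hmax hf
  have hνF : ν.1 F ≠ ⊤ := mt (hsupp F) hF'.ne_zero
  refine ⟨ApproachF.exists_isInitialFactorization hΓ hsupp hF'.ne_zero, ?_⟩
  intro n u φ r hfac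
  have hex (i : Fin n) : ∃ (m : ApproachF.Ext ν₀) (h : ν ≤ m), m.1.supp = Ideal.span {F} ∧
      ApproachF.grMap h (φ i) = 0 := by
    obtain ⟨m, h, hm, hφ⟩ := ApproachF.exists_ext_of_irreducible hΓ hsupp hF'
      (I := Ideal.span {φ i})
      (by rw [Ne, Ideal.span_singleton_eq_top]; exact (hfac.irreducible i).not_isUnit)
      (by
        rw [Ideal.mem_span_singleton, hfac.eq]
        exact ((dvd_pow_self (φ i) (Nat.one_le_iff_ne_zero.1 (hfac.pos i))).trans
          (Finset.dvd_prod_of_mem (fun i => φ i ^ r i) (Finset.mem_univ i))).mul_left _)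
    exact ⟨m, h, hm, hφ _ (hfac.homogeneous i) (Ideal.mem_span_singleton_self _)⟩
  choose m hle hm hφ using hex
  have hlt (i : Fin n) : ν.1 F < (m i).1 F := by
    have : F ∈ (m i).1.supp := by rw [hm]; exact Ideal.mem_span_singleton_self _
    rw [(AddValuation.mem_supp_iff _ _).1 this]
    exact lt_top_iff_ne_top.2 hνF
  refine ⟨fun i => (m i : ApproachF.𝒱 ν₀), fun i j hij => ?_, fun i => ⟨⟨m i, rfl, hm i⟩, ?_⟩⟩
  · have hij : m i = m j := WithBot.coe_injective hij
    by_contra hne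
    -- both `φ i` and `φ j` are associated with the generator of the kernel of the same map
    obtain ⟨g, -, hg, -, hdvd⟩ := ApproachF.exists_prime_initialForm (hle i) ⟨F, hlt i⟩
    have hφj : ApproachF.grMap (hle i) (φ j) = 0 := by
      have : ∀ (m' : ApproachF.Ext ν₀) (h' : ν ≤ m'), m j = m' →
          ApproachF.grMap h' (φ j) = 0 := by
        rintro _ h' rfl
        exact hφ j
      exact this _ _ hij.symm
    have hi := (hg.irreducible.dvd_irreducible_iff_associated (hfac.irreducible i)).1
      (hdvd _ (hφ i))
    have hj := hdvd _ hφj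
    exact hfac.not_dvd i j hne (hi.dvd'.trans hj)
  · refine lt_of_le_of_ne (WithBot.coe_le_coe.2 (hle i)) fun heq => ?_
    have hνm : ν = m i := WithBot.coe_injective heq
    exact absurd (hlt i) (by rw [← hνm]; exact lt_irrefl _)
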